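/- **Setting.** There are $k\ge 2$ agents and $T$ rounds. A realization is a table of bits $\rho=(\rho_i(t))$, $1\le i\le k$, $1\le t\le T$, where $\rho_i(t)=1$ iff agent $i$ is clicked if shown in round $t$. A deterministic allocation rule $\mathcal A$ maps a bid profile $b\in(0,\infty)^k$, a realization $\rho$ and a round $t$ to an agent $\mathcal A(b;\rho;t)$, and it is online: the choice in round $t$ depends only on $b$ and on the clicks observed before $t$ (that is, on $\rho_{\mathcal A(b;\rho;s)}(s)$ for $s<t$). Round $t$ is *influential* for $\rho$ if for some $b$ and some $t'>t$, flipping the bit $\rho_j(t)$ with $j=\mathcal A(b;\rho;t)$ changes $\mathcal A(b;\rho;t')$. The rule $\mathcal A$ is *exploration-separated* if for every $\rho$ and every round $t$ influential for $\rho$, $\mathcal A(b;\rho;t)$ does not depend on $b$. An instance $\mathcal I$ of the stochastic MAB mechanism design problem consists of private values $v\in(0,\infty)^k$ (agents bid truthfully, $b=v$) and click-through rates $\mu\in[0,1]^k$; the bits $\rho_i(t)$ are independent with mean $\mu_i$. The regret of $\mathcal A$ on $\mathcal I$ is $$R_{\mathcal A}^{\mathcal I}(T)=T\max_i\mu_iv_i-\mathbb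 E_\rho\Big[\sum_{t=1}^T \mu_{\mathcal A(v;\rho;t)}\,v_{\mathcal A(v;\rho;t)}\Big].$$ Let $R_{\mathcal A}(T;v_{\max})$ be its supremum over all instances with $v_i\le v_{\max}$ for all $i$. Let $R_{\mathcal A,\delta}(T;v_{\max})$ be its supremum over those of these instances that have $\delta$-gap, i.e. for which the largest of the numbers $\mu_iv_i$ exceeds the second largest (counted with multiplicity) by exactly $\delta\max_iv_i$. (Expectations over $\mathcal A\sim\mathcal D$ of functions that need not be measurable are lower integrals.) **Theorem.** (1) There is an absolute constant $c>0$ such that for all $k\ge2$, $T\ge k$, $v_{\max}>0$ and every probability distribution $\mathcal D$ over exploration-separated deterministic allocation rules for $k$ agents and $T$ rounds, $$\mathbb E_{\mathcal A\sim\mathcal D}\big[R_{\mathcal A}(T;v_{\max})\big]\ \ge\ c\,v_{\max}k^{1/3}T^{2/3},$$ and, moreover, $\sup_{\mathcal I}\mathbb E_{\mathcal A\sim\mathcal D}\big[R_{\mathcal A}^{\mathcal I}(T)\big]\ge c\,v_{\max}k^{1/3}T^{2/3}$, where the supremum is over all instances with values at most $v_{\max}$. (2) Let $\gamma<1$, $\lambda<2(1-\gamma)$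 and $C\in\mathbb R$. There are $c>0$ and $T_1$, depending only on $\gamma,\lambda,C$, such that the following holds for all $k\ge2$, $T\ge T_1$, $v_{\max}>0$ and every distribution $\mathcal D$ as in (1). If $\sup_{\mathcal I}\mathbb E_{\mathcal A\sim\mathcal D}[R_{\mathcal A}^{\mathcal I}(T)]\le C\,v_{\max}T^\gamma$, with the supremum over all instances with values at most $v_{\max}$ (in particular, if $\mathbb E_{\mathcal A\sim\mathcal D}[R_{\mathcal A}(T;v_{\max})]\le C\,v_{\max}T^\gamma$), then for every $\delta\in(0,\tfrac14]$ $$\mathbb E_{\mathcal A\sim\mathcal D}\big[R_{\mathcal A,\delta}(T;v_{\max})\big]\ \ge\ c\,\delta\,v_{\max}T^{\lambda},$$ and, moreover, $\sup_{\mathcal I}\mathbb E_{\mathcal A\sim\mathcal D}[R_{\mathcal A}^{\mathcal I}(T)]\ge c\,\delta\,v_{\max}T^\lambda$, where the supremum is over the $\delta$-gap instances with values at most $v_{\max}$. -/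

import Mathlib

open scoped ENNReal
open MeasureTheory

/-- Vectors of `k` positive reals: values per click, or bids. -/
abbrev Profile (k : ℕ) : Type := Fin k → {x : ℝ // 0 < x}

/-- Click information for all agents and all rounds: `ρ i t` tells whether agent `i`
is clicked if she is shown in round `t`. -/
abbrev Realization (k T : ℕ) : Type := Fin k → Fin T → Bool

/-- The realization that coincides with `ρ` except that the bit of agent `i` at round `t`
is flipped. -/
def Realization.flip {k T : ℕ} (ρ : Realization k T) (i : Fin k) (t : Fin T) :
    Realization k T :=
  Function.update ρ i (Function.update (ρ i) t (!ρ i t))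

/-- A deterministic allocation rule for `k` agents and `T` rounds: it maps a bid profile, a
realization and a round to the agent shown in that round, and it is online, i.e. the choice in
round `t` depends on the bids and on the clicks observed before round `t` only. -/
structure AllocationRule (k T : ℕ) where
  alloc : Profile k → Realization k T → Fin T → Fin k
  online : ∀ (b : Profile k) (ρ ρ' : Realization k T) (t : Fin T),
    (∀ s : Fin T, s < t → ρ (alloc b ρ s) s = ρ' (alloc b ρ s) s) →
      alloc b ρ t = alloc b ρ' t

/-- Round `t` is influential for `ρ`: for some bid profile, flipping the click bit of the agent
shown in round `t` changes the allocation in some later round. -/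
def AllocationRule.Influential {k T : ℕ} (A : AllocationRule k T) (ρ : Realization k T)
    (t : Fin T) : Prop :=
  ∃ (b : Profile k) (t' : Fin T), t < t' ∧
    A.alloc b ρ t' ≠ A.alloc b (ρ.flip (A.alloc b ρ t) t) t'

/-- For every realization, the allocation in any round that is influential for that realization
does not depend on the bids. -/
def AllocationRule.ExplorationSeparated {k T : ℕ} (A : AllocationRule k T) : Prop :=
  ∀ (ρ : Realization k T) (t : Fin T), A.Influential ρ t →
    ∀ b b' : Profile k, A.alloc b ρ t = A.alloc b' ρ t

/-- The exploration-separated deterministic allocation rules. -/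
abbrev SeparatedRule (k T : ℕ) : Type :=
  {A : AllocationRule k T // A.ExplorationSeparated}

/-- The smallest σ-algebra for which the agent chosen at given bids, realization and round is a
random variable. -/
instance AllocationRule.instMeasurableSpace (k T : ℕ) : MeasurableSpace (AllocationRule k T) :=
  ⨆ (b : Profile k) (ρ : Realization k T) (t : Fin T),
    MeasurableSpace.comap (fun A : AllocationRule k T => A.alloc b ρ t) ⊤

/-- An instance of the stochastic problem with `k` agents: the private values (which are also the
bids) and the click-through rates. -/
structure StochasticInstance (k : ℕ) where
  value : Profile k
  ctr : Fin k → Set.Icc (0 : ℝ) 1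

/-- Expected payoff `μ_i v_i` of showing agent `i` once. -/
def StochasticInstance.payoff {k : ℕ} (I : StochasticInstance k) (i : Fin k) : ℝ :=
  (I.ctr i : ℝ) * (I.value i : ℝ)

/-- The expectation of `f` when all bits `ρ i t` are independent and `ρ i t` has mean `μ i`. -/
noncomputable def clickExpectation {k T : ℕ} (μ : Fin k → Set.Icc (0 : ℝ) 1)
    (f : Realization k T → ℝ) : ℝ :=
  ∑ ρ : Realization k T, (∏ i, ∏ t, if ρ i t then (μ i : ℝ) else 1 - (μ i : ℝ)) * f ρ

/-- The regret of an allocation rule on an instance. -/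
noncomputable def AllocationRule.regret {k T : ℕ} (A : AllocationRule k T)
    (I : StochasticInstance k) : ℝ :=
  (T : ℝ) * (⨆ i, I.payoff i) -
    clickExpectation I.ctr
      (fun ρ : Realization k T => ∑ t : Fin T, I.payoff (A.alloc I.value ρ t))

/-- The instances in which all private values are at most `vmax`. -/
def boundedInstances (k : ℕ) (vmax : ℝ) : Set (StochasticInstance k) :=
  {I | ∀ i, (I.value i : ℝ) ≤ vmax}

/-- The instances with `δ`-gap in which all private values are at most `vmax`: the best expected
payoff exceeds the second-best one by exactly `δ` times the largest value. -/
def gapInstances (k : ℕ) (δ vmax : ℝ) : Set (StochasticInstance k) :=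
  {I | I ∈ boundedInstances k vmax ∧
    ∃ i j : Fin k, i ≠ j ∧ (∀ l, I.payoff l ≤ I.payoff i) ∧
      (∀ l, l ≠ i → I.payoff l ≤ I.payoff j) ∧
      I.payoff i - I.payoff j = δ * ⨆ l, (I.value l : ℝ)}

/-- Worst-case regret of a deterministic rule over a class of instances. Regret is nonnegative, so
nothing is lost by taking the supremum in `[0, ∞]`. -/
noncomputable def AllocationRule.worstCaseRegret {k T : ℕ} (A : AllocationRule k T)
    (S : Set (StochasticInstance k)) : ℝ≥0∞ :=
  ⨆ I ∈ S, ENNReal.ofReal (A.regret I)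

/-- The expected worst-case regret `E_{A ∼ D} [sup_I R_A^I]`. -/
noncomputable def expectedWorstCaseRegret {k T : ℕ} (D : Measure (SeparatedRule k T))
    (S : Set (StochasticInstance k)) : ℝ≥0∞ :=
  ∫⁻ A, A.1.worstCaseRegret S ∂D

/-- The worst-case expected regret `sup_I E_{A ∼ D} [R_A^I]`, i.e. the worst-case regret of the
randomized rule `D`. -/
noncomputable def worstCaseExpectedRegret {k T : ℕ} (D : Measure (SeparatedRule k T))
    (S : Set (StochasticInstance k)) : ℝ≥0∞ :=
  ⨆ I ∈ S, ∫⁻ A, ENNReal.ofReal (A.1.regret I) ∂D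

/-! Call a round explored for `i` if `i` is shown there whatever the bids. Separation means that a
click bit of `i` can affect the allocation only in such a round (`ExplorationSeparated.alloc_flip`),
so only explored clicks carry information.

With all rates 1/2, let N_i be the expected number of explored rounds of `i`; it does not depend on
the values. Raising the rate of `i` alone to 1/2 + ε goes largely unnoticed unless ε² N_i is of
constant order (`ExplorationSeparated.clickExpectation_bias_ge`), and missing `i` then costs ε v per
round. Conversely, if all rates stay 1/2 but `i` has the highest value, with gap δ v, every explored
round given to another agent costs δ v. Explored rounds ignore the bids, so one such round is a loss
for k - 1 of the k favoured instances at once.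

Summing both effects over `i` gives a linear inequality for each rule
(`ExplorationSeparated.le_sum_regret`). Being linear, it survives averaging over rules
(`le_worstCaseExpectedRegret_add`). Both claims follow by choosing ε: of order (k/T)^(1/3) for the
first, T^(γ-1) for the second. -/

open scoped Classical in
/-- The indicator that agent `i` is shown in round `t` whatever the bids. -/
noncomputable def AllocationRule.explored {k T : ℕ} (A : AllocationRule k T) (i : Fin k)
    (ρ : Realization k T) (t : Fin T) : ℝ :=
  if ∀ b, A.alloc b ρ t = i then 1 else 0

/-- `1` for a click, `-1` for no click. -/
def clickSign (x : Bool) : ℝ := if x then 1 else -1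

lemma clickSign_not (x : Bool) : clickSign (!x) = -clickSign x := by
  cases x <;> simp [clickSign]

lemma clickSign_sq (x : Bool) : clickSign x ^ 2 = 1 := by
  cases x <;> simp [clickSign]

/-- The click-through rate `1 / 2`. -/
noncomputable def halfRate : Set.Icc (0 : ℝ) 1 := ⟨1 / 2, by norm_num, by norm_num⟩

namespace Realization

variable {k T : ℕ}

lemma flip_same (ρ : Realization k T) (i : Fin k) (t : Fin T) : ρ.flip i t i t = !ρ i t := by
  simp [Realization.flip]

lemma flip_of_ne (ρ : Realization k T) (i : Fin k) (t : Fin T) {j : Fin k} {s : Fin T}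
    (h : j ≠ i ∨ s ≠ t) : ρ.flip i t j s = ρ j s := by
  unfold Realization.flip
  by_cases hj : j = i
  · subst hj
    have hs : s ≠ t := by simpa using h
    simp [hs]
  · simp [hj]

lemma flip_involutive (i : Fin k) (t : Fin T) :
    Function.Involutive (fun ρ : Realization k T => ρ.flip i t) := by
  intro ρ
  funext j s
  by_cases h : j ≠ i ∨ s ≠ t
  · simp only [flip_of_ne _ i t h]
  · push Not at h
    obtain ⟨rfl, rfl⟩ := h
    simp only [flip_same, Bool.not_not]

end Realization

/-! ### Expectations over clicks and the change of measure at rate 1/2. -/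

section Expectation

variable {k T : ℕ}

lemma clickExpectation_const (μ : Fin k → Set.Icc (0 : ℝ) 1) (c : ℝ) :
    clickExpectation (T := T) μ (fun _ => c) = c := by
  unfold clickExpectation
  rw [← Finset.sum_mul]
  have h1 : ∀ i : Fin k, ∑ r : Fin T → Bool, ∏ t, (if r t then (μ i : ℝ) else 1 - (μ i : ℝ)) = 1 := by
    intro i
    have := Finset.prod_univ_sum (fun _ : Fin T => (Finset.univ : Finset Bool))
      (fun _ x => if x then (μ i : ℝ) else 1 - (μ i : ℝ))
    rw [Fintype.piFinset_univ] at this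
    rw [← this]
    simp
  have h2 := Finset.prod_univ_sum (fun _ : Fin k => (Finset.univ : Finset (Fin T → Bool)))
    (fun i r => ∏ t, if r t then (μ i : ℝ) else 1 - (μ i : ℝ))
  rw [Fintype.piFinset_univ] at h2
  rw [← h2]
  simp [h1]

lemma clickExpectation_add (μ : Fin k → Set.Icc (0 : ℝ) 1) (f g : Realization k T → ℝ) :
    clickExpectation μ (fun ρ => f ρ + g ρ) = clickExpectation μ f + clickExpectation μ g := by
  simp [clickExpectation, mul_add, Finset.sum_add_distrib]

lemma clickExpectation_sub (μ : Fin k → Set.Icc (0 : ℝ) 1) (f g : Realization k T → ℝ) :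
    clickExpectation μ (fun ρ => f ρ - g ρ) = clickExpectation μ f - clickExpectation μ g := by
  simp [clickExpectation, mul_sub, Finset.sum_sub_distrib]

lemma clickExpectation_const_mul (μ : Fin k → Set.Icc (0 : ℝ) 1) (c : ℝ)
    (f : Realization k T → ℝ) :
    clickExpectation μ (fun ρ => c * f ρ) = c * clickExpectation μ f := by
  simp only [clickExpectation, Finset.mul_sum]
  exact Finset.sum_congr rfl fun ρ _ => by ring

lemma clickExpectation_sum {ι : Type*} (s : Finset ι) (μ : Fin k → Set.Icc (0 : ℝ) 1)
    (f : ι → Realization k T → ℝ) :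
    clickExpectation μ (fun ρ => ∑ j ∈ s, f j ρ) = ∑ j ∈ s, clickExpectation μ (f j) := by
  simp only [clickExpectation, Finset.mul_sum]
  exact Finset.sum_comm

lemma clickExpectation_mono (μ : Fin k → Set.Icc (0 : ℝ) 1) {f g : Realization k T → ℝ}
    (h : ∀ ρ, f ρ ≤ g ρ) : clickExpectation μ f ≤ clickExpectation μ g := by
  refine Finset.sum_le_sum fun ρ _ => mul_le_mul_of_nonneg_left (h ρ) ?_
  refine Finset.prod_nonneg fun i _ => Finset.prod_nonneg fun t _ => ?_
  split_ifs
  · exact (μ i).2.1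
  · exact sub_nonneg.2 (μ i).2.2

lemma clickExpectation_half (f : Realization k T → ℝ) :
    clickExpectation (fun _ => halfRate) f =
      (∏ _i : Fin k, ∏ _t : Fin T, (1 / 2 : ℝ)) * ∑ ρ, f ρ := by
  rw [clickExpectation, Finset.mul_sum]
  refine Finset.sum_congr rfl fun ρ _ => ?_
  congr 1
  refine Finset.prod_congr rfl fun i _ => Finset.prod_congr rfl fun t _ => ?_
  simp only [halfRate]
  split_ifs <;> norm_num

/-- At rate 1/2 flipping a bit preserves the measure. This symmetry replaces conditioning on the
past in all martingale arguments below. -/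
lemma clickExpectation_half_eq_zero_of_flip_neg (i : Fin k) (t : Fin T)
    {f : Realization k T → ℝ} (h : ∀ ρ : Realization k T, f (ρ.flip i t) = -f ρ) :
    clickExpectation (fun _ => halfRate) f = 0 := by
  rw [clickExpectation_half]
  have h1 := Equiv.sum_comp (Realization.flip_involutive (k := k) (T := T) i t).toPerm f
  simp only [Function.Involutive.coe_toPerm, h, Finset.sum_neg_distrib] at h1
  have : ∑ ρ, f ρ = 0 := by linarith
  rw [this, mul_zero]

/-- Change of measure when only the click-through rate of agent `i` is changed. -/
lemma clickExpectation_bias (i : Fin k) {ε : ℝ} (μ : Fin k → Set.Icc (0 : ℝ) 1)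
    (hi : (μ i : ℝ) = 1 / 2 + ε) (hμ : ∀ j, j ≠ i → μ j = halfRate) (f : Realization k T → ℝ) :
    clickExpectation μ f = clickExpectation (fun _ => halfRate)
      (fun ρ => (∏ t, (1 + 2 * ε * clickSign (ρ i t))) * f ρ) := by
  rw [clickExpectation_half, Finset.mul_sum, clickExpectation]
  refine Finset.sum_congr rfl fun ρ _ => ?_
  rw [← mul_assoc]
  congr 1
  rw [← Finset.mul_prod_erase _ _ (Finset.mem_univ i),
    ← Finset.mul_prod_erase (Finset.univ : Finset (Fin k)) (fun _ => ∏ _t : Fin T, (1 / 2 : ℝ))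
      (Finset.mem_univ i), mul_right_comm, ← Finset.prod_mul_distrib]
  congr 1
  · refine Finset.prod_congr rfl fun t _ => ?_
    rw [hi]
    cases ρ i t <;> simp [clickSign] <;> ring
  · refine Finset.prod_congr rfl fun j hj => Finset.prod_congr rfl fun t _ => ?_
    rw [hμ j (Finset.ne_of_mem_erase hj)]
    simp only [halfRate]
    split_ifs <;> norm_num

end Expectation

/-- From log(1 + y) ≥ y/(1 + y) ≥ y - 2y² for |y| ≤ 1/2, multiplied up and followed by exp x ≥ 1 +
x. It linearizes the likelihood ratio from below. -/
lemma one_add_sum_sub_le_prod_one_add {ι : Type*} (s : Finset ι) (y : ι → ℝ)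
    (hy : ∀ j ∈ s, |y j| ≤ 1 / 2) :
    1 + ∑ j ∈ s, y j - 2 * ∑ j ∈ s, y j ^ 2 ≤ ∏ j ∈ s, (1 + y j) := by
  have h1 : ∀ j ∈ s, Real.exp (y j - 2 * y j ^ 2) ≤ 1 + y j := by
    intro j hj
    have h := abs_le.1 (hy j hj)
    have hpos : 0 < 1 + y j := by linarith
    rw [← Real.le_log_iff_exp_le hpos]
    refine le_trans ?_ (Real.one_sub_inv_le_log_of_pos hpos)
    have h2 : 1 - (1 + y j)⁻¹ = y j / (1 + y j) := by field_simp; ring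
    rw [h2, le_div_iff₀ hpos]
    nlinarith [mul_nonneg (sq_nonneg (y j)) (by linarith : 0 ≤ 1 + 2 * y j)]
  calc 1 + ∑ j ∈ s, y j - 2 * ∑ j ∈ s, y j ^ 2
      = ∑ j ∈ s, (y j - 2 * y j ^ 2) + 1 := by
        rw [Finset.sum_sub_distrib, Finset.mul_sum]; ring
    _ ≤ Real.exp (∑ j ∈ s, (y j - 2 * y j ^ 2)) := Real.add_one_le_exp _
    _ = ∏ j ∈ s, Real.exp (y j - 2 * y j ^ 2) := Real.exp_sum _ _
    _ ≤ _ := Finset.prod_le_prod (fun _ _ => (Real.exp_pos _).le) h1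

/-! ### Only explored clicks carry information. -/

namespace AllocationRule

variable {k T : ℕ} (A : AllocationRule k T)

lemma explored_sq (i : Fin k) (ρ : Realization k T) (t : Fin T) :
    A.explored i ρ t ^ 2 = A.explored i ρ t := by
  unfold explored; split_ifs <;> simp

lemma explored_nonneg (i : Fin k) (ρ : Realization k T) (t : Fin T) :
    0 ≤ A.explored i ρ t := by
  unfold explored; split_ifs <;> simp

lemma explored_le_one (i : Fin k) (ρ : Realization k T) (t : Fin T) :
    A.explored i ρ t ≤ 1 := by
  unfold explored; split_ifs <;> simp

lemma alloc_flip_of_le (b : Profile k) (ρ : Realization k T) (i : Fin k) {s t : Fin T}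
    (h : s ≤ t) : A.alloc b (ρ.flip i t) s = A.alloc b ρ s := by
  refine (A.online b ρ _ s fun r hr => ?_).symm
  rw [Realization.flip_of_ne _ _ _ (Or.inr (hr.trans_le h).ne)]

lemma explored_flip_of_le (ρ : Realization k T) (i j : Fin k) {s t : Fin T} (h : s ≤ t) :
    A.explored j (ρ.flip i t) s = A.explored j ρ s := by
  classical exact if_congr (by simp only [A.alloc_flip_of_le _ ρ i h]) rfl rfl

variable {A}

/-- The clicks of an agent in a round matter only if she is shown there whatever the bids. -/
lemma ExplorationSeparated.alloc_flip (hA : A.ExplorationSeparated) {ρ : Realization k T}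
    {i : Fin k} {t : Fin T} (h : A.explored i ρ t = 0) (b : Profile k) (s : Fin T) :
    A.alloc b (ρ.flip i t) s = A.alloc b ρ s := by
  have h' : ¬∀ b, A.alloc b ρ t = i := by
    intro h'
    simp [explored, h'] at h
  -- If `i` is shown at `b`, a later change would make round `t` influential, hence explored for
  -- `i`. If `i` is not shown at `b`, the bit is never observed there.
  by_cases hb : A.alloc b ρ t = i
  · rcases le_or_gt s t with hst | hst
    · exact A.alloc_flip_of_le b ρ i hst
    · by_contra hne
      refine h' fun b' => ?_
      rw [← hb]
      refine hA ρ t ⟨b, s, hst, ?_⟩ b' b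
      rw [hb]
      exact Ne.symm hne
  · refine (A.online b ρ _ s fun r _ => ?_).symm
    rw [Realization.flip_of_ne]
    by_contra hr
    push Not at hr
    exact hb (hr.2 ▸ hr.1)

lemma ExplorationSeparated.explored_flip (hA : A.ExplorationSeparated) {ρ : Realization k T}
    {i : Fin k} {t : Fin T} (h : A.explored i ρ t = 0) (s : Fin T) :
    A.explored i (ρ.flip i t) s = A.explored i ρ s := by
  classical exact if_congr (by simp only [hA.alloc_flip h]) rfl rfl

variable (A)

lemma explored_eq_zero_or_one (i : Fin k) (ρ : Realization k T) (t : Fin T) :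
    A.explored i ρ t = 0 ∨ A.explored i ρ t = 1 := by
  unfold explored; split_ifs <;> simp

variable {A}

/-- The factors of the likelihood ratio that belong to clicks without influence may be dropped. -/
lemma ExplorationSeparated.clickExpectation_prod_mul (hA : A.ExplorationSeparated) (i : Fin k)
    (ε : ℝ) {h : Realization k T → ℝ}
    (hh : ∀ ρ t, A.explored i ρ t = 0 → h (ρ.flip i t) = h ρ) (U : Finset (Fin T)) :
    clickExpectation (fun _ => halfRate) (fun ρ => (∏ t ∈ U, (1 + 2 * ε * clickSign (ρ i t))) *
        (∏ t ∈ Uᶜ, (1 + 2 * ε * clickSign (ρ i t) * A.explored i ρ t)) * h ρ) =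
      clickExpectation (fun _ => halfRate)
        (fun ρ => (∏ t, (1 + 2 * ε * clickSign (ρ i t) * A.explored i ρ t)) * h ρ) := by
  -- `U` holds the rounds that keep the full factor; moving one round at a time into `U` leaves the
  -- expectation unchanged.
  induction U using Finset.induction_on with
  | empty => simp
  | insert t U ht ih =>
    rw [← ih, ← sub_eq_zero, ← clickExpectation_sub]
    have hc : Uᶜ = insert t (insert t U)ᶜ := by
      ext s; by_cases hs : s = t
      · subst hs; simp [ht]
      · simp [hs]
    have ht' : t ∉ (insert t U)ᶜ := by simp
    -- The increment contains the click sign times (1 - explored). It vanishes if round `t` is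
    -- explored for `i`; otherwise nothing else reacts to this bit, so it is odd under the flip.
    have hrw : ∀ ρ : Realization k T,
        (∏ t ∈ insert t U, (1 + 2 * ε * clickSign (ρ i t))) *
          (∏ t ∈ (insert t U)ᶜ, (1 + 2 * ε * clickSign (ρ i t) * A.explored i ρ t)) * h ρ -
        (∏ t ∈ U, (1 + 2 * ε * clickSign (ρ i t))) *
          (∏ t ∈ Uᶜ, (1 + 2 * ε * clickSign (ρ i t) * A.explored i ρ t)) * h ρ =
        clickSign (ρ i t) * ((1 - A.explored i ρ t) * (2 * ε *
          ((∏ t ∈ U, (1 + 2 * ε * clickSign (ρ i t))) *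
          (∏ t ∈ (insert t U)ᶜ, (1 + 2 * ε * clickSign (ρ i t) * A.explored i ρ t)) * h ρ))) := by
      intro ρ
      rw [hc, Finset.prod_insert ht', Finset.prod_insert ht]
      ring
    simp only [hrw]
    refine clickExpectation_half_eq_zero_of_flip_neg i t fun ρ => ?_
    rw [Realization.flip_same, clickSign_not, A.explored_flip_of_le ρ i i le_rfl]
    rcases A.explored_eq_zero_or_one i ρ t with h0 | h1
    · have e1 : ∏ s ∈ U, (1 + 2 * ε * clickSign (ρ.flip i t i s)) =
          ∏ s ∈ U, (1 + 2 * ε * clickSign (ρ i s)) :=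
        Finset.prod_congr rfl fun s hs => by
          rw [Realization.flip_of_ne _ _ _ (Or.inr (ne_of_mem_of_not_mem hs ht))]
      have e2 : ∏ s ∈ (insert t U)ᶜ,
            (1 + 2 * ε * clickSign (ρ.flip i t i s) * A.explored i (ρ.flip i t) s) =
          ∏ s ∈ (insert t U)ᶜ, (1 + 2 * ε * clickSign (ρ i s) * A.explored i ρ s) :=
        Finset.prod_congr rfl fun s hs => by
          rw [Realization.flip_of_ne _ _ _ (Or.inr (ne_of_mem_of_not_mem hs ht')), hA.explored_flip h0]
      rw [e1, e2, hh ρ t h0]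
      ring
    · rw [h1]; ring

variable (A)

/-- The signed count of explored clicks is a martingale. -/
lemma clickExpectation_sum_sq (i : Fin k) :
    clickExpectation (fun _ => halfRate)
        (fun ρ : Realization k T => (∑ t, clickSign (ρ i t) * A.explored i ρ t) ^ 2) =
      clickExpectation (fun _ => halfRate) (fun ρ : Realization k T => ∑ t, A.explored i ρ t) := by
  -- Flip the later bit: by onlineness neither exploration indicator sees it, so the cross term is
  -- odd.
  have hlt : ∀ s t : Fin T, s < t → clickExpectation (fun _ => halfRate)
      (fun ρ : Realization k T => clickSign (ρ i s) * A.explored i ρ s *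
        (clickSign (ρ i t) * A.explored i ρ t)) = 0 := by
    intro s t hst
    refine clickExpectation_half_eq_zero_of_flip_neg i t fun ρ => ?_
    rw [Realization.flip_same, clickSign_not, A.explored_flip_of_le ρ i i le_rfl,
      A.explored_flip_of_le ρ i i hst.le, Realization.flip_of_ne _ _ _ (Or.inr hst.ne)]
    ring
  simp only [pow_two, Finset.sum_mul_sum]
  rw [clickExpectation_sum, clickExpectation_sum]
  refine Finset.sum_congr rfl fun s _ => ?_
  rw [clickExpectation_sum, Finset.sum_eq_single s]
  · congr 1
    funext ρ
    rw [← pow_two, mul_pow, clickSign_sq, explored_sq, one_mul]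
  · intro t _ hts
    rcases lt_or_gt_of_ne hts with h | h
    · rw [← hlt t s h]
      congr 1
      funext ρ
      ring
    · exact hlt s t h
  · simp

variable {A}

/-- Few explored clicks of agent `i` do not suffice to notice that she is better. -/
lemma ExplorationSeparated.clickExpectation_bias_ge (hA : A.ExplorationSeparated) (i : Fin k)
    {ε M : ℝ} (hε : 0 ≤ ε) (hε' : ε ≤ 1 / 4) (μ : Fin k → Set.Icc (0 : ℝ) 1)
    (hi : (μ i : ℝ) = 1 / 2 + ε) (hμ : ∀ j, j ≠ i → μ j = halfRate)
    {h : Realization k T → ℝ} (h0 : ∀ ρ, 0 ≤ h ρ) (hM : ∀ ρ, h ρ ≤ M)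
    (hh : ∀ ρ t, A.explored i ρ t = 0 → h (ρ.flip i t) = h ρ) :
    clickExpectation (fun _ => halfRate) h - M / 8 - 16 * ε ^ 2 * M *
        clickExpectation (fun _ => halfRate)
          (fun ρ : Realization k T => ∑ t, A.explored i ρ t) ≤
      clickExpectation μ h := by
  have key := hA.clickExpectation_prod_mul i ε hh Finset.univ
  simp only [Finset.compl_univ, Finset.prod_empty, mul_one] at key
  rw [clickExpectation_bias i μ hi hμ, key]
  have hpt : ∀ ρ : Realization k T, h ρ - M * (1 / 8 + 8 * ε ^ 2 *
      (∑ t, clickSign (ρ i t) * A.explored i ρ t) ^ 2 + 8 * ε ^ 2 * ∑ t, A.explored i ρ t) ≤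
      (∏ t, (1 + 2 * ε * clickSign (ρ i t) * A.explored i ρ t)) * h ρ := by
    intro ρ
    have hp := one_add_sum_sub_le_prod_one_add Finset.univ
      (fun t => 2 * ε * clickSign (ρ i t) * A.explored i ρ t) (by
        intro t _
        have hs : |clickSign (ρ i t)| = 1 := by cases ρ i t <;> simp [clickSign]
        rw [abs_mul, abs_mul, hs, abs_of_nonneg (by positivity : 0 ≤ 2 * ε),
          abs_of_nonneg (A.explored_nonneg i ρ t)]
        nlinarith [A.explored_le_one i ρ t, A.explored_nonneg i ρ t])
    have e1 : ∑ t, 2 * ε * clickSign (ρ i t) * A.explored i ρ t =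
        2 * ε * ∑ t, clickSign (ρ i t) * A.explored i ρ t := by
      rw [Finset.mul_sum]; exact Finset.sum_congr rfl fun t _ => by ring
    have e2 : ∑ t, (2 * ε * clickSign (ρ i t) * A.explored i ρ t) ^ 2 =
        4 * ε ^ 2 * ∑ t, A.explored i ρ t := by
      rw [Finset.mul_sum]
      refine Finset.sum_congr rfl fun t _ => ?_
      rw [mul_pow, mul_pow, clickSign_sq, explored_sq]; ring
    rw [e1, e2] at hp
    set Z := ∑ t, clickSign (ρ i t) * A.explored i ρ t
    set N := ∑ t, A.explored i ρ t
    have hN : 0 ≤ N := Finset.sum_nonneg fun t _ => A.explored_nonneg i ρ t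
    have hX : 0 ≤ 1 / 8 + 8 * ε ^ 2 * Z ^ 2 + 8 * ε ^ 2 * N := by positivity
    have hp' : 1 - (1 / 8 + 8 * ε ^ 2 * Z ^ 2 + 8 * ε ^ 2 * N) ≤
        ∏ t, (1 + 2 * ε * clickSign (ρ i t) * A.explored i ρ t) := by
      -- The square gives 2εZ ≥ -1/8 - 8ε²Z². Since Z² and N have equal expectation, the two terms
      -- 8ε² add up to 16ε².
      nlinarith [sq_nonneg (8 * ε * Z + 1)]
    have h1 := mul_le_mul_of_nonneg_right hp' (h0 ρ)
    have h2 := mul_le_mul_of_nonneg_right (hM ρ) hX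
    linarith
  refine le_trans (le_of_eq ?_) (clickExpectation_mono _ hpt)
  rw [clickExpectation_sub, clickExpectation_const_mul, clickExpectation_add, clickExpectation_add,
    clickExpectation_const, clickExpectation_const_mul, clickExpectation_const_mul,
    A.clickExpectation_sum_sq]
  ring

lemma regret_eq (A : AllocationRule k T) (I : StochasticInstance k) :
    A.regret I = clickExpectation I.ctr (fun ρ : Realization k T =>
      ∑ t, ((⨆ i, I.payoff i) - I.payoff (A.alloc I.value ρ t))) := by
  simp only [Finset.sum_sub_distrib]
  rw [clickExpectation_sub, clickExpectation_const, regret]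
  simp

end AllocationRule

/-! ### Two families of hard instances and the inequality between their regrets. -/

/-- All values are `v`, and agent `i` is clicked slightly more often than the others. -/
noncomputable def biasedInstance {k : ℕ} (v : {x : ℝ // 0 < x}) (ε : Set.Icc (0 : ℝ) (1 / 4))
    (i : Fin k) : StochasticInstance k where
  value := fun _ => v
  ctr := fun j => if j = i then
      ⟨1 / 2 + ε, by linarith [ε.2.1], by linarith [ε.2.2]⟩ else halfRate

/-- All click-through rates are `1 / 2`, and agent `i` has a slightly higher value. -/
noncomputable def favouredInstance {k : ℕ} (v : {x : ℝ // 0 < x}) (δ : Set.Icc (0 : ℝ) (1 / 4))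
    (i : Fin k) : StochasticInstance k where
  -- The factor 2 offsets the rate 1/2, so the payoff gap is exactly δ v.
  value := fun j => if j = i then v else
    ⟨v * (1 - 2 * δ), mul_pos v.2 (by linarith [δ.2.2])⟩
  ctr := fun _ => halfRate

namespace AllocationRule

variable {k T : ℕ}

/-- The number of rounds in which agent `i` is not shown. -/
def missed (A : AllocationRule k T) (b : Profile k) (i : Fin k) (ρ : Realization k T) : ℝ :=
  ∑ t, if A.alloc b ρ t = i then 0 else 1

lemma le_regret (A : AllocationRule k T) (I : StochasticInstance k) (i : Fin k) {c : ℝ}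
    (hc : ∀ j, j ≠ i → c ≤ I.payoff i - I.payoff j) :
    c * clickExpectation I.ctr (A.missed I.value i) ≤ A.regret I := by
  rw [regret_eq, ← clickExpectation_const_mul]
  refine clickExpectation_mono _ fun ρ => ?_
  rw [missed, Finset.mul_sum]
  refine Finset.sum_le_sum fun t _ => ?_
  have hle : ∀ j, I.payoff j ≤ ⨆ i, I.payoff i := fun j =>
    le_ciSup (Set.finite_range I.payoff).bddAbove j
  split_ifs with h
  · simpa using hle _
  · linarith [hc _ h, hle i]

lemma sum_missed (A : AllocationRule k T) (b : Profile k) (ρ : Realization k T) :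
    ∑ i, A.missed b i ρ = (k - 1) * T := by
  have h : ∀ j : Fin k, ∑ i, (if j = i then (0 : ℝ) else 1) = k - 1 := by
    intro j
    have h1 : ∀ i : Fin k, (if j = i then (0 : ℝ) else 1) = 1 - if j = i then 1 else 0 := by
      intro i; split_ifs <;> simp
    simp [h1]
  simp only [missed]
  rw [Finset.sum_comm]
  simp only [h, Finset.sum_const, Finset.card_univ, Fintype.card_fin, nsmul_eq_mul, mul_comm]

/-- A round explored for `j` goes to `j` under every profile `b i`, so it is missed for each of the
k - 1 indices `i ≠ j`, although the profiles differ. -/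
lemma sum_explored_le (A : AllocationRule k T) (b : Fin k → Profile k) (ρ : Realization k T) :
    (k - 1) * ∑ i, ∑ t, A.explored i ρ t ≤ ∑ i, A.missed (b i) i ρ := by
  classical
  simp only [missed]
  rw [Finset.sum_comm, Finset.sum_comm (γ := Fin k) (α := Fin T), Finset.mul_sum]
  refine Finset.sum_le_sum fun t _ => ?_
  by_cases h : ∃ j, ∀ b, A.alloc b ρ t = j
  · obtain ⟨j, hj⟩ := h
    have h1 : ∀ i : Fin k, (if j = i then (0 : ℝ) else 1) = 1 - if j = i then 1 else 0 := by
      intro i; split_ifs <;> simp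
    have h2 : ∀ i, A.explored i ρ t = if j = i then 1 else 0 := fun i =>
      if_congr (by simp [hj, forall_const]) rfl rfl
    simp [hj, h1, h2]
  · have h2 : ∀ i, A.explored i ρ t = 0 := fun i => if_neg fun hi => h ⟨i, hi⟩
    simp only [h2, Finset.sum_const_zero, mul_zero]
    exact Finset.sum_nonneg fun i _ => by split_ifs <;> simp

/-- A separated rule has large regret on some biased instance, unless it explores a lot, and then
it has large regret on some instance with equal click-through rates. -/
lemma ExplorationSeparated.le_sum_regret {A : AllocationRule k T} (hA : A.ExplorationSeparated)
    (hk : 2 ≤ k) (v : {x : ℝ // 0 < x}) (ε δ : Set.Icc (0 : ℝ) (1 / 4)) (hδ : 0 < (δ : ℝ)) :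
    k * (3 / 8 * (ε : ℝ) * T * (v : ℝ)) ≤ ∑ i, A.regret (biasedInstance v ε i) +
      32 * (ε : ℝ) ^ 3 * T / (k * (δ : ℝ)) * ∑ i, A.regret (favouredInstance v δ i) := by
  have hv : 0 < (v : ℝ) := v.2
  have hε : 0 ≤ (ε : ℝ) := ε.2.1
  have hk' : (2 : ℝ) ≤ k := by exact_mod_cast hk
  set N : Fin k → ℝ := fun i => clickExpectation (fun _ => halfRate)
    (fun ρ : Realization k T => ∑ t, A.explored i ρ t) with hN
  have hN0 : 0 ≤ ∑ i, N i := Finset.sum_nonneg fun i _ => by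
    rw [← clickExpectation_const (T := T) (fun _ : Fin k => halfRate) 0]
    exact clickExpectation_mono _ fun ρ =>
      Finset.sum_nonneg fun t _ => A.explored_nonneg i ρ t
  have hI : ∀ i, (ε : ℝ) * (v : ℝ) * (clickExpectation (fun _ => halfRate) (A.missed (fun _ => v) i) - T / 8 -
      16 * (ε : ℝ) ^ 2 * T * N i) ≤ A.regret (biasedInstance v ε i) := by
    intro i
    refine le_trans ?_ (A.le_regret (biasedInstance v ε i) i (c := ε * v) ?_)
    · refine mul_le_mul_of_nonneg_left ?_ (by positivity)
      refine hA.clickExpectation_bias_ge i hε ε.2.2 _ (by simp [biasedInstance])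
        (fun j hj => by simp [biasedInstance, hj]) (fun ρ => ?_) (fun ρ => ?_) fun ρ t h0 => ?_
      · exact Finset.sum_nonneg fun t _ => by split_ifs <;> simp
      · refine (Finset.sum_le_sum (g := fun _ => (1 : ℝ)) fun t _ => ?_).trans (by simp)
        split_ifs <;> simp
      · simp only [missed, hA.alloc_flip h0]
    · intro j hj
      simp only [StochasticInstance.payoff, biasedInstance, hj, if_true, if_false, halfRate]
      linarith
  have hJ : ∀ i, (δ : ℝ) * (v : ℝ) * clickExpectation (fun _ => halfRate)
      (A.missed (favouredInstance v δ i).value i) ≤ A.regret (favouredInstance v δ i) := by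
    intro i
    refine A.le_regret (favouredInstance v δ i) i fun j hj => ?_
    simp only [StochasticInstance.payoff, favouredInstance, hj, if_true, if_false, halfRate]
    linarith
  have hI' := Finset.sum_le_sum fun i (_ : i ∈ Finset.univ) => hI i
  have hJ' := Finset.sum_le_sum fun i (_ : i ∈ Finset.univ) => hJ i
  rw [← Finset.mul_sum, Finset.sum_sub_distrib, Finset.sum_sub_distrib, ← clickExpectation_sum,
    ← Finset.mul_sum] at hI'
  simp only [sum_missed, clickExpectation_const] at hI'
  simp only [Finset.sum_const, Finset.card_univ, Fintype.card_fin, nsmul_eq_mul] at hI'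
  rw [← Finset.mul_sum, ← clickExpectation_sum] at hJ'
  have hJ2 : (k - 1) * ∑ i, N i ≤ clickExpectation (fun _ => halfRate)
      (fun ρ => ∑ i, A.missed (favouredInstance v δ i).value i ρ) := by
    rw [hN, ← clickExpectation_sum, ← clickExpectation_const_mul]
    exact clickExpectation_mono _ fun ρ => A.sum_explored_le _ ρ
  have hJ3 : (δ : ℝ) * (v : ℝ) * (k / 2 * ∑ i, N i) ≤ ∑ i, A.regret (favouredInstance v δ i) := by
    refine le_trans (mul_le_mul_of_nonneg_left (le_trans ?_ hJ2) (by positivity)) hJ'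
    exact mul_le_mul_of_nonneg_right (by linarith) hN0
  have hJ4 := mul_le_mul_of_nonneg_left hJ3
    (show (0 : ℝ) ≤ 32 * ε ^ 3 * T / (k * δ) by positivity)
  have e : 32 * (ε : ℝ) ^ 3 * T / (k * δ) * (δ * v * (k / 2 * ∑ i, N i)) =
      16 * ε ^ 3 * T * v * ∑ i, N i := by
    field_simp
    ring
  rw [e] at hJ4
  -- For k ≥ 2 this yields (k - 1) - k/8 ≥ 3k/8, the source of the constant 3/8.
  have h5 : 0 ≤ (ε : ℝ) * (v : ℝ) * T * ((k : ℝ) - 2) := by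
    have : (0 : ℝ) ≤ k - 2 := by linarith
    positivity
  nlinarith

lemma measurable_regret (I : StochasticInstance k) :
    Measurable (fun A : AllocationRule k T => A.regret I) := by
  have h : ∀ (b : Profile k) (ρ : Realization k T) (t : Fin T),
      Measurable (fun A : AllocationRule k T => A.alloc b ρ t) := by
    intro b ρ t
    refine measurable_iff_comap_le.2 ?_
    exact le_iSup_of_le b (le_iSup_of_le ρ (le_iSup_of_le t le_rfl))
  unfold regret clickExpectation
  refine Measurable.const_sub (Finset.measurable_sum _ fun ρ _ => Measurable.const_mul
    (Finset.measurable_sum _ fun t _ => ?_) _) _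
  exact (measurable_of_countable I.payoff).comp (h _ ρ t)

end AllocationRule

/-! ### Averaging over random rules. -/

section Distributions

variable {k T : ℕ} (D : Measure (SeparatedRule k T))

lemma worstCaseExpectedRegret_le (S : Set (StochasticInstance k)) :
    worstCaseExpectedRegret D S ≤ expectedWorstCaseRegret D S :=
  iSup₂_le fun I hI => lintegral_mono fun A =>
    le_iSup₂ (f := fun I (_ : I ∈ S) => ENNReal.ofReal (A.1.regret I)) I hI

lemma worstCaseExpectedRegret_mono {S S' : Set (StochasticInstance k)} (h : S ⊆ S') :
    worstCaseExpectedRegret D S ≤ worstCaseExpectedRegret D S' :=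
  biSup_mono h

lemma biasedInstance_mem (v : {x : ℝ // 0 < x}) (ε : Set.Icc (0 : ℝ) (1 / 4)) (i : Fin k) :
    biasedInstance v ε i ∈ boundedInstances k v := fun _ => le_rfl

lemma favouredInstance_mem (hk : 2 ≤ k) (v : {x : ℝ // 0 < x}) (δ : Set.Icc (0 : ℝ) (1 / 4))
    (i : Fin k) : favouredInstance v δ i ∈ gapInstances k δ v := by
  have hv : 0 < (v : ℝ) := v.2
  have hvδ : 0 ≤ (v : ℝ) * δ := mul_nonneg hv.le δ.2.1
  have hval : ∀ j, ((favouredInstance v δ i).value j : ℝ) ≤ v := by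
    intro j
    simp only [favouredInstance]
    split_ifs
    · exact le_rfl
    · simp only; linarith
  have : Nontrivial (Fin k) := Fin.nontrivial_iff_two_le.2 hk
  obtain ⟨j, hj⟩ := exists_ne i
  have hsup : ⨆ l, ((favouredInstance v δ i).value l : ℝ) = v := by
    refine le_antisymm (ciSup_le hval) ?_
    refine le_trans (le_of_eq ?_) (le_ciSup (Set.finite_range _).bddAbove i)
    simp [favouredInstance]
  refine ⟨hval, i, j, hj.symm, fun l => ?_, fun l hl => ?_, ?_⟩
  · by_cases hl : l = i
    · rw [hl]
    · simp only [StochasticInstance.payoff, favouredInstance, hl, if_true, if_false, halfRate]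
      linarith
  · simp [StochasticInstance.payoff, favouredInstance, hl, hj]
  · rw [hsup]
    simp only [StochasticInstance.payoff, favouredInstance, hj, if_true, if_false, halfRate]
    ring

lemma lintegral_sum_regret_le {S : Set (StochasticInstance k)} {I : Fin k → StochasticInstance k}
    (hI : ∀ i, I i ∈ S) :
    ∫⁻ A, ENNReal.ofReal (∑ i, A.1.regret (I i)) ∂D ≤ k * worstCaseExpectedRegret D S := by
  calc ∫⁻ A, ENNReal.ofReal (∑ i, A.1.regret (I i)) ∂D
      ≤ ∫⁻ A, ∑ i, ENNReal.ofReal (A.1.regret (I i)) ∂D := by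
        refine lintegral_mono fun A => ?_
        exact Finset.le_sum_of_subadditive _ ENNReal.ofReal_zero.le
          (fun _ _ => ENNReal.ofReal_add_le) _ _
    _ = ∑ i, ∫⁻ A, ENNReal.ofReal (A.1.regret (I i)) ∂D :=
        lintegral_finsetSum _ fun i _ => (((AllocationRule.measurable_regret (I i)).comp
          measurable_subtype_coe).ennreal_ofReal)
    _ ≤ ∑ _i : Fin k, worstCaseExpectedRegret D S := by
        refine Finset.sum_le_sum fun i _ => ?_
        exact le_iSup₂ (f := fun I (_ : I ∈ S) => ∫⁻ A, ENNReal.ofReal (A.1.regret I) ∂D)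
          (I i) (hI i)
    _ = _ := by simp

/-- The trade-off between worst-case regret and regret on instances with a gap. -/
lemma le_worstCaseExpectedRegret_add [IsProbabilityMeasure D] (hk : 2 ≤ k) {v ε δ : ℝ}
    (hv : 0 < v) (hε : 0 ≤ ε) (hε' : ε ≤ 1 / 4) (hδ : 0 < δ) (hδ' : δ ≤ 1 / 4) :
    ENNReal.ofReal (3 / 8 * ε * T * v) ≤ worstCaseExpectedRegret D (boundedInstances k v) +
      ENNReal.ofReal (32 * ε ^ 3 * T / (k * δ)) *
        worstCaseExpectedRegret D (gapInstances k δ v) := by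
  have hk0 : (k : ℝ≥0∞) ≠ 0 := by simp; omega
  -- Scaling by k matches the inequality for a single rule, which sums over all k positions of the
  -- special agent.
  rw [← ENNReal.mul_le_mul_iff_right hk0 (ENNReal.natCast_ne_top k)]
  let v' : {x : ℝ // 0 < x} := ⟨v, hv⟩
  let ε' : Set.Icc (0 : ℝ) (1 / 4) := ⟨ε, hε, hε'⟩
  let d : Set.Icc (0 : ℝ) (1 / 4) := ⟨δ, hδ.le, hδ'⟩
  have hc : 0 ≤ 32 * ε ^ 3 * T / (k * δ) := by positivity
  have hm : Measurable (fun A : SeparatedRule k T =>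
      ENNReal.ofReal (∑ i, A.1.regret (biasedInstance v' ε' i))) :=
    (Finset.measurable_sum _ fun i _ => (AllocationRule.measurable_regret _).comp
      measurable_subtype_coe).ennreal_ofReal
  calc (k : ℝ≥0∞) * ENNReal.ofReal (3 / 8 * ε * T * v)
      = ∫⁻ _A, ENNReal.ofReal (k * (3 / 8 * ε * T * v)) ∂D := by
        rw [lintegral_const, measure_univ, mul_one, ENNReal.ofReal_mul (Nat.cast_nonneg k),
          ENNReal.ofReal_natCast]
    _ ≤ ∫⁻ A, (ENNReal.ofReal (∑ i, A.1.regret (biasedInstance v' ε' i)) +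
          ENNReal.ofReal (32 * ε ^ 3 * T / (k * δ)) *
            ENNReal.ofReal (∑ i, A.1.regret (favouredInstance v' d i))) ∂D := by
        refine lintegral_mono fun A => ?_
        rw [← ENNReal.ofReal_mul hc]
        exact (ENNReal.ofReal_le_ofReal (A.2.le_sum_regret hk v' ε' d hδ)).trans
          ENNReal.ofReal_add_le
    _ = ∫⁻ A, ENNReal.ofReal (∑ i, A.1.regret (biasedInstance v' ε' i)) ∂D +
          ENNReal.ofReal (32 * ε ^ 3 * T / (k * δ)) *
            ∫⁻ A, ENNReal.ofReal (∑ i, A.1.regret (favouredInstance v' d i)) ∂D := by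
        rw [lintegral_add_left hm, lintegral_const_mul' _ _ ENNReal.ofReal_ne_top]
    _ ≤ k * worstCaseExpectedRegret D (boundedInstances k v) +
          ENNReal.ofReal (32 * ε ^ 3 * T / (k * δ)) *
            (k * worstCaseExpectedRegret D (gapInstances k δ v)) := by
        gcongr
        · exact lintegral_sum_regret_le D fun i => biasedInstance_mem v' ε' i
        · exact lintegral_sum_regret_le D fun i => favouredInstance_mem hk v' d i
    _ = _ := by ring

end Distributions

/-! ### Choice of the bias, and the two lower bounds. -/

lemma ofReal_le_worstCaseExpectedRegret {k T : ℕ} (hk : 2 ≤ k) (hkT : k ≤ T) {v : ℝ} (hv : 0 < v)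
    (D : Measure (SeparatedRule k T)) [IsProbabilityMeasure D] :
    ENNReal.ofReal (1 / 32 * v * (k : ℝ) ^ (1 / 3 : ℝ) * (T : ℝ) ^ (2 / 3 : ℝ)) ≤
      worstCaseExpectedRegret D (boundedInstances k v) := by
  have hk0 : (0 : ℝ) < k := by exact_mod_cast (by omega : 0 < k)
  have hT0 : (0 : ℝ) < T := by exact_mod_cast (by omega : 0 < T)
  set x : ℝ := ((k : ℝ) / T) ^ (1 / 3 : ℝ) with hx
  have hx0 : 0 ≤ x := by positivity
  have hx1 : x ≤ 1 := Real.rpow_le_one (by positivity)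
    ((div_le_one hT0).2 (by exact_mod_cast hkT)) (by norm_num)
  have hx3 : x ^ 3 = k / T := by
    rw [hx, ← Real.rpow_natCast, ← Real.rpow_mul (by positivity)]
    norm_num
  have hxT : x * T = (k : ℝ) ^ (1 / 3 : ℝ) * (T : ℝ) ^ (2 / 3 : ℝ) := by
    rw [hx, Real.div_rpow hk0.le hT0.le, div_mul_eq_mul_div, mul_div_assoc]
    congr 1
    rw [div_eq_iff (by positivity), ← Real.rpow_add hT0]
    norm_num
  -- As x³ = k/T, this bias makes the coefficient of the gap regret the constant 2; k ≤ T keeps it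
  -- at most 1/4. Gap instances are bounded instances, so three copies of one supremum dominate 3/32
  -- · x T v.
  have h := le_worstCaseExpectedRegret_add D hk (ε := x / 4) (δ := 1 / 4) hv (by positivity)
    (by linarith) (by norm_num) le_rfl
  have e1 : 32 * (x / 4) ^ 3 * T / (k * (1 / 4)) = 2 := by
    rw [div_pow, hx3]
    field_simp
    norm_num
  have h2 := worstCaseExpectedRegret_mono D (S := gapInstances k (1 / 4) v) fun I hI => hI.1
  rw [e1, ENNReal.ofReal_ofNat] at h
  have h3 : ENNReal.ofReal (3 / 8 * (x / 4) * T * v) ≤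
      3 * worstCaseExpectedRegret D (boundedInstances k v) := by
    refine h.trans ((add_le_add_right (mul_le_mul_right h2 2) _).trans (le_of_eq ?_))
    ring
  rw [← ENNReal.mul_le_mul_iff_right (a := 3) (by simp) (by simp)]
  refine le_trans (le_of_eq ?_) h3
  rw [← ENNReal.ofReal_ofNat, ← ENNReal.ofReal_mul (by norm_num)]
  congr 1
  rw [mul_assoc (1 / 32 * v), ← hxT]
  ring

/-- A randomized separated rule with worst-case regret at most `B v T ^ γ` explores so much that
its regret on instances with a gap is large. -/
lemma ofReal_le_worstCaseExpectedRegret_gap {k T : ℕ} (hk : 2 ≤ k) {γ lam B : ℝ} (hB : 0 < B)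
    (hT : 1 ≤ T) (hTB : 16 / 3 * B * (T : ℝ) ^ (γ - 1) ≤ 1 / 4) (hlam : lam ≤ 2 * (1 - γ))
    {v : ℝ} (hv : 0 < v) (D : Measure (SeparatedRule k T)) [IsProbabilityMeasure D]
    (hD : worstCaseExpectedRegret D (boundedInstances k v) ≤ ENNReal.ofReal (B * v * (T : ℝ) ^ γ))
    {δ : ℝ} (hδ : 0 < δ) (hδ' : δ ≤ 1 / 4) :
    ENNReal.ofReal (3 / (256 * (16 / 3 * B) ^ 2) * δ * v * (T : ℝ) ^ lam) ≤
      worstCaseExpectedRegret D (gapInstances k δ v) := by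
  have hT1 : (1 : ℝ) ≤ T := by exact_mod_cast hT
  have hT0 : (0 : ℝ) < T := by linarith
  have hk' : (2 : ℝ) ≤ k := by exact_mod_cast hk
  set W := worstCaseExpectedRegret D (gapInstances k δ v) with hWdef
  by_cases hW : W = ⊤
  · simp [hW]
  set y : ℝ := (T : ℝ) ^ (γ - 1) with hy
  have hy0 : 0 < y := by positivity
  have hyT : y * T = (T : ℝ) ^ γ := by
    rw [hy, ← Real.rpow_add_one hT0.ne']
    norm_num
  -- With this bias the assumed bound B v T^γ is exactly half of 3/8 · ε T v, so the gap term must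
  -- supply the other half.
  set ε := 16 / 3 * B * y with hε
  have hε0 : 0 < ε := by positivity
  have h := le_worstCaseExpectedRegret_add D hk hv hε0.le hTB hδ hδ'
  have h1 := h.trans (add_le_add_left hD _)
  rw [← hWdef, ← ENNReal.ofReal_toReal hW, ← ENNReal.ofReal_mul (by positivity),
    ← ENNReal.ofReal_add (by positivity) (by positivity),
    ENNReal.ofReal_le_ofReal_iff (by positivity)] at h1
  rw [← ENNReal.ofReal_toReal hW]
  refine ENNReal.ofReal_le_ofReal ?_
  have hw : 0 ≤ W.toReal := ENNReal.toReal_nonneg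
  have e1 : B * v * (T : ℝ) ^ γ = 3 / 16 * ε * T * v := by
    rw [← hyT, hε]; ring
  -- Replacing k by 2 makes the final constant independent of k.
  have e2 : 32 * ε ^ 3 * T / (k * δ) * W.toReal ≤ 16 * ε ^ 3 * T / δ * W.toReal := by
    refine mul_le_mul_of_nonneg_right ?_ hw
    rw [div_le_div_iff₀ (by positivity) hδ]
    nlinarith [show 0 ≤ 16 * ε ^ 3 * T * δ * (k - 2) from
      mul_nonneg (by positivity) (by linarith)]
  have h2 : 3 / 16 * ε * T * v ≤ 16 * ε ^ 3 * T / δ * W.toReal := by linarith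
  have h3 : 3 / (256 * ε ^ 2) * δ * v ≤ W.toReal := by
    have hpos : 0 < 16 * ε ^ 3 * T / δ := by positivity
    refine le_of_mul_le_mul_left (le_trans (le_of_eq ?_) h2) hpos
    field_simp
    norm_num
  refine le_trans ?_ h3
  have e4 : (T : ℝ) ^ lam ≤ (y ^ 2)⁻¹ := by
    rw [hy, ← Real.rpow_natCast, ← Real.rpow_mul hT0.le, ← Real.rpow_neg hT0.le]
    refine Real.rpow_le_rpow_of_exponent_le hT1 ?_
    push_cast
    linarith
  calc 3 / (256 * (16 / 3 * B) ^ 2) * δ * v * (T : ℝ) ^ lam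
      ≤ 3 / (256 * (16 / 3 * B) ^ 2) * δ * v * (y ^ 2)⁻¹ := by gcongr
    _ = _ := by rw [hε]; field_simp

theorem mainTheorem7 :
    (∃ c : ℝ, 0 < c ∧ ∀ (k T : ℕ), 2 ≤ k → k ≤ T → ∀ vmax : ℝ, 0 < vmax →
      ∀ D : Measure (SeparatedRule k T), IsProbabilityMeasure D →
        ENNReal.ofReal (c * vmax * (k : ℝ) ^ (1 / 3 : ℝ) * (T : ℝ) ^ (2 / 3 : ℝ)) ≤
            expectedWorstCaseRegret D (boundedInstances k vmax) ∧
        ENNReal.ofReal (c * vmax * (k : ℝ) ^ (1 / 3 : ℝ) * (T : ℝ) ^ (2 / 3 : ℝ)) ≤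
            worstCaseExpectedRegret D (boundedInstances k vmax)) ∧
    (∀ γ lam C : ℝ, γ < 1 → lam < 2 * (1 - γ) →
      ∃ c : ℝ, 0 < c ∧ ∃ T₁ : ℕ, ∀ (k T : ℕ), 2 ≤ k → T₁ ≤ T → ∀ vmax : ℝ, 0 < vmax →
        ∀ D : Measure (SeparatedRule k T), IsProbabilityMeasure D →
          worstCaseExpectedRegret D (boundedInstances k vmax) ≤
            ENNReal.ofReal (C * vmax * (T : ℝ) ^ γ) →
          ∀ δ : ℝ, 0 < δ → δ ≤ 1 / 4 →
            ENNReal.ofReal (c * δ * vmax * (T : ℝ) ^ lam) ≤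
                expectedWorstCaseRegret D (gapInstances k δ vmax) ∧
            ENNReal.ofReal (c * δ * vmax * (T : ℝ) ^ lam) ≤
                worstCaseExpectedRegret D (gapInstances k δ vmax)) := by
  refine ⟨⟨1 / 32, by norm_num, fun k T hk hkT v hv D _ => ?_⟩, fun γ lam C hγ hlam => ?_⟩
  · have h := ofReal_le_worstCaseExpectedRegret hk hkT hv D
    exact ⟨h.trans (worstCaseExpectedRegret_le D _), h⟩
  -- `C` may be nonpositive; enlarging it to `max C 1` weakens the regret assumption and gives a
  -- positive bias. The threshold on T then ensures that the bias is at most 1/4.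
  · have hB : 0 < max C 1 := lt_max_of_lt_right one_pos
    have hlim : Filter.Tendsto (fun n : ℕ => 16 / 3 * max C 1 * (n : ℝ) ^ (γ - 1)) Filter.atTop
        (nhds 0) := by
      have h := ((tendsto_rpow_neg_atTop (by linarith : 0 < 1 - γ)).comp
        tendsto_natCast_atTop_atTop).const_mul (16 / 3 * max C 1)
      simpa using h
    obtain ⟨T₀, hT₀⟩ := Filter.eventually_atTop.1
      (hlim.eventually_le_const (by norm_num : (0 : ℝ) < 1 / 4))
    refine ⟨3 / (256 * (16 / 3 * max C 1) ^ 2), by positivity, max T₀ 1,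
      fun k T hk hT v hv D _ hD δ hδ hδ' => ?_⟩
    have h := ofReal_le_worstCaseExpectedRegret_gap hk hB ((le_max_right _ _).trans hT)
      (hT₀ T ((le_max_left _ _).trans hT)) hlam.le hv D
      (hD.trans (ENNReal.ofReal_le_ofReal (by gcongr; exact le_max_left _ _))) hδ hδ'
    exact ⟨h.trans (worstCaseExpectedRegret_le D _), h⟩
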